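/- Let $G=(V,E)$ be a finite tree. For $u,v\in V$ let $d(u,v)$ be the distance between $u$ and $v$, and let $H(u,v)$ be the hitting time, i.e. the expected number of steps that the simple random walk on $G$ started in $u$ (which in every step moves to a uniformly random neighbour of the current node) makes before it visits $v$ for the first time, with $H(v,v)=0$. The Closeness and the Random-Walk Closeness (RW-Closeness) centrality of a node $v$ are \[ C_v(G)=\Bigl(\sum_{u\in V\setminus\{v\}} d(u,v)\Bigr)^{-1},\qquad RWC_v(G)=\Bigl(\sum_{u\in V\setminus\{v\}} H(u,v)\Bigr)^{-1} \] (for a tree with one node, where the sums are empty, the values are $0$ by convention). \textbf{Theorem.} In every finite tree $G$ all hitting times $H(u,v)$ are finite, and Closeness and RW-Closeness centralities impose the same ranking of nodes: for all $u,v\in V$, \[ C_u(G)\le C_v(G)\iff RWC_u(G)\le RWC_v(G). \] -/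

import Mathlib

open MeasureTheory ProbabilityTheory
open scoped ENNReal

namespace TreeCentrality

open scoped Classical in
/-- One step of the random walk on `G`: from `u`, move to a uniformly random neighbour of `u`.
At an isolated node (where there is no edge to follow) the walk stays where it is. -/
noncomputable def step {V : Type*} [Fintype V] (G : SimpleGraph V) (u : V) : PMF V :=
  if h : (G.neighborFinset u).Nonempty then PMF.uniformOfFinset (G.neighborFinset u) h
  else PMF.pure u

/-- The transition kernel of the random walk at time `n`: it depends on the history
`(x 0, …, x n)` only through the current node `x n`. -/
noncomputable def walkKernel {V : Type*} [Fintype V] [MeasurableSpace V]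
    [DiscreteMeasurableSpace V] (G : SimpleGraph V) (n : ℕ) :
    Kernel ((_ : Finset.Iic n) → V) V where
  toFun x := (step G (x ⟨n, Finset.mem_Iic.2 le_rfl⟩)).toMeasure
  measurable' := (Measurable.of_discrete (f := fun u : V => (step G u).toMeasure)).comp
    (measurable_pi_apply _)

instance instIsMarkovKernelWalkKernel {V : Type*} [Fintype V] [MeasurableSpace V]
    [DiscreteMeasurableSpace V] (G : SimpleGraph V) (n : ℕ) :
    IsMarkovKernel (walkKernel G n) :=
  ⟨fun x => PMF.toMeasure.isProbabilityMeasure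
    (step G (x ⟨n, Finset.mem_Iic.2 le_rfl⟩))⟩

/-- The law, on the space of infinite sequences of nodes, of the random walk on `G` that starts
in `u`. -/
noncomputable def walkLaw {V : Type*} [Fintype V] [MeasurableSpace V]
    [DiscreteMeasurableSpace V] (G : SimpleGraph V) (u : V) : Measure (ℕ → V) :=
  Kernel.trajMeasure (X := fun _ => V) (Measure.dirac u) (walkKernel G)

/-- The hitting time `H(u, v)`: the expectation, for the random walk that starts in `u`, of the
first time `t ≥ 0` at which the walk is in `v` (`∞` on the trajectories that never visit `v`). -/
noncomputable def hittingTime {V : Type*} [Fintype V] (G : SimpleGraph V) (u v : V) : ℝ≥0∞ :=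
  letI : MeasurableSpace V := ⊤
  ∫⁻ x : ℕ → V, ENat.toENNReal (hittingAfter (fun t (y : ℕ → V) => y t) {v} 0 x) ∂(walkLaw G u)

open scoped Classical in
/-- Closeness centrality. -/
noncomputable def closeness {V : Type*} [Fintype V] (G : SimpleGraph V) (v : V) : ℝ :=
  (∑ u ∈ Finset.univ \ {v}, (G.dist u v : ℝ))⁻¹

open scoped Classical in
/-- Random-walk closeness centrality. -/
noncomputable def rwCloseness {V : Type*} [Fintype V] (G : SimpleGraph V) (v : V) : ℝ :=
  (∑ u ∈ Finset.univ \ {v}, (hittingTime G u v).toReal)⁻¹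

end TreeCentrality

/-! In a tree with n nodes the hitting time has the closed form `treePotential`. Distances to a
fixed node change by exactly one along each edge, which yields the first-step equation h(u,v) = 1 +
(average of h(x,v) over neighbours x of u) for u ≠ v, with h(v,v) = 0
(`sum_neighborFinset_treePotential`). A finite nonnegative solution of these equations must be the
expected hitting time (`lintegral_hittingAfter_eq`). Summing the closed form over u gives (2n - 1) ∑
d(u,v) - c with c independent of v (`exists_sum_treePotential_eq`), so both sums order the nodes
alike. -/

namespace TreeCentrality

/-! ### Distance and degree identities in a tree -/

section Tree

variable {V : Type*} {G : SimpleGraph V}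

/-- In a tree, every node other than `v` has exactly one neighbour closer to `v`; all its other
neighbours are further away from `v`. -/
theorem exists_adj_dist_of_ne (hG : G.IsTree) {u v : V} (huv : u ≠ v) :
    ∃ p, G.Adj u p ∧ G.dist p v + 1 = G.dist u v ∧
      ∀ x, G.Adj u x → x ≠ p → G.dist x v = G.dist u v + 1 := by
  have cons_isPath {x : V} (h : G.Adj u x) (hd : G.dist x v + 1 = G.dist u v) :
      ∃ q : G.Walk x v, (SimpleGraph.Walk.cons h q).IsPath := by
    obtain ⟨q, hq⟩ := hG.connected.exists_walk_length_eq_dist x v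
    refine ⟨q, SimpleGraph.Walk.isPath_of_length_eq_dist _ ?_⟩
    rw [SimpleGraph.Walk.length_cons, hq, hd]
  obtain ⟨w, hw⟩ := hG.connected.exists_walk_length_eq_dist u v
  cases w with
  | nil => exact absurd rfl huv
  | @cons _ p _ h q =>
    have hp : G.dist p v + 1 = G.dist u v := by
      have h1 := SimpleGraph.dist_le q
      have h2 := hG.connected.dist_triangle (u := u) (v := p) (w := v)
      rw [SimpleGraph.dist_eq_one_iff_adj.2 h] at h2
      rw [SimpleGraph.Walk.length_cons] at hw
      omega
    refine ⟨p, h, hp, fun x hx hxp => ?_⟩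
    rcases hG.dist_eq_dist_add_one_of_adj v hx with h1 | h1
    · rw [SimpleGraph.dist_comm, SimpleGraph.dist_comm (u := v)] at h1
      obtain ⟨q₁, hq₁⟩ := cons_isPath h hp
      obtain ⟨q₂, hq₂⟩ := cons_isPath hx h1.symm
      have := congrArg SimpleGraph.Walk.snd ((hG.existsUnique_path u v).unique hq₂ hq₁)
      exact absurd (by simpa using this) hxp
    · rw [SimpleGraph.dist_comm, SimpleGraph.dist_comm (u := u), h1]

variable [Fintype V]

open scoped Classical in
theorem sum_neighborFinset_dist (hG : G.IsTree) (φ : ℝ → ℝ) (u v : V) :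
    ∑ x ∈ G.neighborFinset u, φ (G.dist x v) = G.degree u * φ (G.dist u v + 1) +
      if u = v then 0 else φ (G.dist u v - 1) - φ (G.dist u v + 1) := by
  split_ifs with huv
  · subst huv
    have (x) (hx : x ∈ G.neighborFinset u) : φ (G.dist x u) = φ 1 := by
      rw [SimpleGraph.dist_eq_one_iff_adj.2 ((G.mem_neighborFinset u x).1 hx).symm, Nat.cast_one]
    rw [Finset.sum_congr rfl this]
    simp
  · obtain ⟨p, hp, hpd, h⟩ := exists_adj_dist_of_ne hG huv
    have hmem : p ∈ G.neighborFinset u := (G.mem_neighborFinset u p).2 hp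
    have (x) (hx : x ∈ (G.neighborFinset u).erase p) :
        φ (G.dist x v) = φ (G.dist u v + 1) := by
      rw [Finset.mem_erase, G.mem_neighborFinset] at hx
      rw [h x hx.2 hx.1, Nat.cast_add_one]
    have hcard : (((G.neighborFinset u).erase p).card : ℝ) = G.degree u - 1 := by
      rw [← G.card_neighborFinset_eq_degree, ← Finset.card_erase_add_one hmem]
      push_cast
      ring
    rw [← Finset.add_sum_erase _ _ hmem, Finset.sum_congr rfl this, Finset.sum_const,
      nsmul_eq_mul, hcard, ← hpd]
    push_cast
    rw [add_sub_cancel_right]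
    ring

open scoped Classical in
theorem sum_sum_neighborFinset (G : SimpleGraph V) (g : V → ℝ) :
    ∑ u, ∑ x ∈ G.neighborFinset u, g x = ∑ u, G.degree u * g u := by
  rw [Finset.sum_comm' (t' := Finset.univ) (s' := fun x => G.neighborFinset x)]
  · simp
  · simp [G.adj_comm]

open scoped Classical in
theorem sum_dist_neighborFinset (hG : G.IsTree) (u v : V) :
    ∑ x ∈ G.neighborFinset u, (G.dist x v : ℝ) =
      G.degree u * (G.dist u v + 1) - 2 + if u = v then 2 else 0 := by
  rw [sum_neighborFinset_dist hG (fun t => t) u v]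
  split_ifs <;> ring

open scoped Classical in
theorem sum_degree (hG : G.IsTree) :
    ∑ w, (G.degree w : ℝ) = 2 * Fintype.card V - 2 := by
  obtain ⟨v⟩ := hG.connected.nonempty
  have h := sum_sum_neighborFinset G fun x => (G.dist x v : ℝ)
  simp only [sum_dist_neighborFinset hG, mul_add, mul_one, Finset.sum_add_distrib,
    Finset.sum_sub_distrib, Finset.sum_ite_eq', Finset.mem_univ, if_true, Finset.sum_const,
    Finset.card_univ, nsmul_eq_mul] at h
  linarith

-- Squared distances are summed over all adjacent pairs: double counting cancels the quadratic terms
-- and leaves a linear relation.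
open scoped Classical in
theorem sum_degree_mul_dist (hG : G.IsTree) (v : V) :
    ∑ w, (G.degree w : ℝ) * G.dist w v = 2 * ∑ w, (G.dist w v : ℝ) - (Fintype.card V - 1) := by
  have h := sum_sum_neighborFinset G fun x => (G.dist x v : ℝ) ^ 2
  have key (u : V) : ∑ x ∈ G.neighborFinset u, (G.dist x v : ℝ) ^ 2 =
      G.degree u * (G.dist u v : ℝ) ^ 2 + 2 * (G.degree u * G.dist u v) + G.degree u
        - 4 * G.dist u v := by
    rw [sum_neighborFinset_dist hG (fun t => t ^ 2) u v]
    split_ifs with huv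
    -- The correction (d - 1)² - (d + 1)² = -4d vanishes at d = 0, so u = v is no exception.
    · simp [huv]
    · ring
  simp only [key, Finset.sum_add_distrib, Finset.sum_sub_distrib, ← Finset.mul_sum,
    sum_degree hG] at h
  linarith

open scoped Classical in
/-- The closed form of the hitting time from `u` to `v` in a tree. -/
noncomputable def treePotential (G : SimpleGraph V) (u v : V) : ℝ :=
  2⁻¹ * ∑ w, (G.degree w : ℝ) * (G.dist u v + G.dist w v - G.dist u w)

theorem treePotential_nonneg (hG : G.IsTree) (u v : V) : 0 ≤ treePotential G u v := by
  refine mul_nonneg (by norm_num) (Finset.sum_nonneg fun w _ => mul_nonneg (by positivity) ?_)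
  have := hG.connected.dist_triangle (u := u) (v := v) (w := w)
  rw [SimpleGraph.dist_comm (u := v)] at this
  have : (G.dist u w : ℝ) ≤ G.dist u v + G.dist w v := by exact_mod_cast this
  linarith

theorem treePotential_self (G : SimpleGraph V) (v : V) : treePotential G v v = 0 := by
  simp [treePotential, SimpleGraph.dist_comm (u := v)]

-- The -2 from d(x,v) cancels the -2 from d(x,w) for every w except w = u; the surviving term,
-- halved, is -deg u.
open scoped Classical in
theorem sum_neighborFinset_treePotential (hG : G.IsTree) {u v : V} (huv : u ≠ v) :
    ∑ x ∈ G.neighborFinset u, treePotential G x v =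
      G.degree u * (treePotential G u v - 1) := by
  have key (w : V) : ∑ x ∈ G.neighborFinset u,
      (G.degree w : ℝ) * (G.dist x v + G.dist w v - G.dist x w) =
      G.degree u * (G.degree w * (G.dist u v + G.dist w v - G.dist u w)) -
        if u = w then 2 * (G.degree w : ℝ) else 0 := by
    rw [← Finset.mul_sum, Finset.sum_sub_distrib, Finset.sum_add_distrib,
      sum_dist_neighborFinset hG, sum_dist_neighborFinset hG, if_neg huv, Finset.sum_const,
      G.card_neighborFinset_eq_degree, nsmul_eq_mul]
    split_ifs <;> ring
  simp only [treePotential]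
  rw [← Finset.mul_sum, Finset.sum_comm, Finset.sum_congr rfl fun w _ => key w,
    Finset.sum_sub_distrib, Finset.sum_ite_eq, if_pos (Finset.mem_univ _), ← Finset.mul_sum]
  ring

theorem one_le_treePotential (hG : G.IsTree) {u v : V} (huv : u ≠ v) :
    1 ≤ treePotential G u v := by
  classical
  obtain ⟨p, hp, -⟩ := exists_adj_dist_of_ne hG huv
  have hdeg : (0 : ℝ) < G.degree u := by
    exact_mod_cast (G.degree_pos_iff_exists_adj u).2 ⟨p, hp⟩
  exact sub_nonneg.1 <| nonneg_of_mul_nonneg_right (sum_neighborFinset_treePotential hG huv ▸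
    Finset.sum_nonneg fun x _ => treePotential_nonneg hG x v) hdeg

/-- The total hitting time of `v` is an increasing affine function of the total distance to `v`,
with coefficients that do not depend on `v`. -/
theorem exists_sum_treePotential_eq (hG : G.IsTree) :
    ∃ c : ℝ, ∀ v, ∑ u, treePotential G u v =
      (2 * Fintype.card V - 1) * ∑ u, (G.dist u v : ℝ) - c := by
  classical
  -- Both parts collect what is free of v: n copies of the n - 1 from `sum_degree_mul_dist`, and the
  -- double sum of deg(w) d(u,w).
  refine ⟨2⁻¹ * (Fintype.card V * (Fintype.card V - 1) +
    ∑ u, ∑ w, (G.degree w : ℝ) * G.dist u w), fun v => ?_⟩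
  have key (u : V) : treePotential G u v = 2⁻¹ * ((2 * Fintype.card V - 2) * G.dist u v +
      (2 * ∑ w, (G.dist w v : ℝ) - (Fintype.card V - 1)) -
      ∑ w, (G.degree w : ℝ) * G.dist u w) := by
    simp only [treePotential, mul_add, mul_sub, Finset.sum_add_distrib, Finset.sum_sub_distrib,
      ← Finset.sum_mul, sum_degree hG, sum_degree_mul_dist hG]
  simp only [key, ← Finset.mul_sum, Finset.sum_add_distrib, Finset.sum_sub_distrib,
    Finset.sum_const, Finset.card_univ, nsmul_eq_mul]
  ring

end Tree

/-! ### Hitting times from the first-step equations -/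

section Walk

variable {V : Type*}

/-- The trajectories that avoid `v` up to time `t`. -/
def avoiding (v : V) (t : ℕ) : Set (ℕ → V) := {x | ∀ s ≤ t, x s ≠ v}

theorem toENNReal_eq_tsum (τ : ℕ∞) :
    ENat.toENNReal τ = ∑' t : ℕ, if (t : ℕ∞) < τ then 1 else 0 := by
  induction τ using ENat.recTopCoe with
  | top => simp
  | coe n =>
    rw [tsum_eq_sum (s := Finset.range n) fun t ht =>
      if_neg (by simpa using Finset.mem_range.not.1 ht)]
    rw [Finset.sum_congr rfl (g := fun _ => 1) fun t ht =>
      if_pos (by exact_mod_cast Finset.mem_range.1 ht)]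
    simp

/-- Pathwise form of E[τ] = ∑ P(τ > t): the event τ > t is `avoiding v t`. -/
theorem hittingAfter_eq_tsum (v : V) (x : ℕ → V) :
    ENat.toENNReal (hittingAfter (fun t (y : ℕ → V) => y t) {v} 0 x) =
      ∑' t, (avoiding v t).indicator 1 x := by
  classical
  refine (toENNReal_eq_tsum _).trans (tsum_congr fun t => ?_)
  have h := not_congr (hittingAfter_le_iff (u := fun t (y : ℕ → V) => y t) (s := {v}) (n := 0)
    (i := t) (ω := x))
  have h' : ((∃ j ∈ Set.Icc 0 t, x j ∈ ({v} : Set V)) ↔ x ∉ avoiding v t) := by simp [avoiding]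
  rw [not_le, h', not_not] at h
  by_cases hx : x ∈ avoiding v t
  · exact (if_pos (h.2 hx)).trans (Set.indicator_of_mem hx 1).symm
  · exact (if_neg (h.not.2 hx)).trans (Set.indicator_of_notMem hx 1).symm

variable [Fintype V] [MeasurableSpace V] [DiscreteMeasurableSpace V]

theorem measurableSet_avoiding (v : V) (t : ℕ) : MeasurableSet (avoiding v t) := by
  have : avoiding v t = ⋂ s ≤ t, (fun x : ℕ → V => x s) ⁻¹' {v}ᶜ := by
    ext x
    simp [avoiding]
  rw [this]
  exact MeasurableSet.iInter fun s => MeasurableSet.iInter fun _ =>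
    measurable_pi_apply s (MeasurableSet.singleton v).compl

variable {G : SimpleGraph V}

instance (u : V) : IsProbabilityMeasure (walkLaw G u) :=
  inferInstanceAs (IsProbabilityMeasure (Kernel.trajMeasure (X := fun _ => V) _ _))

/-- The Markov property of the walk, on the event that it has not yet visited `v`. -/
theorem setLIntegral_avoiding_succ (u v : V) (f : V → ℝ≥0∞) (t : ℕ) :
    ∫⁻ x in avoiding v t, f (x (t + 1)) ∂walkLaw G u =
      ∫⁻ x in avoiding v t, ∫⁻ y, f y ∂(step G (x t)).toMeasure ∂walkLaw G u := by
  have hf : Measurable f := .of_discrete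
  have ht : t ∈ Finset.Iic t := Finset.mem_Iic.2 le_rfl
  let A : Set ((_ : Finset.Iic t) → V) := {x | ∀ s, x s ≠ v}
  have hA : MeasurableSet A := by
    have : A = ⋂ s, (fun x => x s) ⁻¹' {v}ᶜ := by
      ext x
      simp [A]
    rw [this]
    exact MeasurableSet.iInter fun s => measurable_pi_apply s (MeasurableSet.singleton v).compl
  have hAv (x : ℕ → V) : Preorder.frestrictLe (π := fun _ => V) t x ∈ A ↔ x ∈ avoiding v t := by
    simp [A, avoiding]
  let F : ((_ : Finset.Iic t) → V) × V → ℝ≥0∞ := (A ×ˢ Set.univ).indicator fun p => f p.2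
  have hF : Measurable F := (hf.comp measurable_snd).indicator (hA.prod .univ)
  -- The history up to t together with the next node has law history ⊗ kernel; `F` is tested against
  -- it.
  have h := congrArg (fun μ => ∫⁻ p, F p ∂μ)
    (Kernel.map_frestrictLe_trajMeasure_compProd_eq_map_trajMeasure (X := fun _ => V)
      (μ₀ := Measure.dirac u) (κ := walkKernel G) (a := t))
  rw [← lintegral_indicator (measurableSet_avoiding v t),
    ← lintegral_indicator (measurableSet_avoiding v t)]
  have hr : Measurable (Preorder.frestrictLe (π := fun _ : ℕ => V) t) :=
    Preorder.measurable_frestrictLe t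
  rw [Measure.lintegral_compProd hF, lintegral_map (Measurable.lintegral_kernel_prod_right' hF) hr,
    lintegral_map hF (by fun_prop)] at h
  refine Eq.trans ?_ (h.symm.trans ?_)
  · refine lintegral_congr fun x => ?_
    by_cases hx : x ∈ avoiding v t <;> simp [F, hAv, hx, Set.indicator]
  · refine lintegral_congr fun x => ?_
    by_cases hx : x ∈ avoiding v t
    · simp only [F, Set.indicator, Set.mem_prod, hAv, hx, Set.mem_univ, and_true, if_true]
      rfl
    · simp [F, hAv, hx, Set.indicator]

theorem walkLaw_map_zero (u : V) : (walkLaw G u).map (fun x => x 0) = Measure.dirac u := by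
  have h := Kernel.traj_map_frestrictLe_apply (X := fun _ => V) (κ := walkKernel G) 0 0
    ((MeasurableEquiv.piUnique fun _ : Finset.Iic 0 => V).symm u)
  rw [Kernel.partialTraj_self, Kernel.id_apply] at h
  have h0 : (0 : ℕ) ∈ Finset.Iic 0 := Finset.mem_Iic.2 le_rfl
  have h' := congrArg (Measure.map fun x => x ⟨0, h0⟩) h
  have hm : Measurable fun x : (_ : Finset.Iic 0) → V => x ⟨0, h0⟩ := measurable_pi_apply _
  rw [Measure.map_map hm (Preorder.measurable_frestrictLe 0)] at h'
  have hd : walkLaw G u = Kernel.traj (X := fun _ => V) (walkKernel G) 0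
      ((MeasurableEquiv.piUnique fun _ : Finset.Iic 0 => V).symm u) :=
    (congrArg (fun μ => Measure.bind μ (Kernel.traj (X := fun _ => V) (walkKernel G) 0))
      (Measure.map_dirac' (MeasurableEquiv.measurable _) u)).trans
      (Measure.dirac_bind (Kernel.measurable _) _)
  rw [hd]
  exact h'.trans (Measure.map_dirac' hm _)

/-- With P t = P(τ > t) and A t = E[f(X_t); τ > t], the step equation gives A t = P t + A (t + 1).
This telescopes from A 0 = f u, and A t → 0, so ∑ P t = f u. -/
theorem lintegral_hittingAfter_eq {v : V} {f : V → ℝ≥0∞} (hfin : ∀ u, f u ≠ ∞) (hv : f v = 0)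
    (hstep : ∀ u ≠ v, f u = 1 + ∫⁻ y, f y ∂(step G u).toMeasure) (u : V) :
    ∫⁻ x : ℕ → V, ENat.toENNReal (hittingAfter (fun t (y : ℕ → V) => y t) {v} 0 x)
      ∂walkLaw G u = f u := by
  have hf : Measurable f := .of_discrete
  set A : ℕ → ℝ≥0∞ := fun t => ∫⁻ x in avoiding v t, f (x t) ∂walkLaw G u with hA
  set P : ℕ → ℝ≥0∞ := fun t => walkLaw G u (avoiding v t) with hP
  have hA0 : A 0 = f u := by
    have : A 0 = ∫⁻ x, f (x 0) ∂walkLaw G u := by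
      simp only [hA]
      rw [← lintegral_indicator (measurableSet_avoiding v 0)]
      refine lintegral_congr fun x => ?_
      by_cases hx : x 0 = v <;> simp [avoiding, Set.indicator, hx, hv]
    rw [this, ← lintegral_map hf (measurable_pi_apply 0), walkLaw_map_zero, lintegral_dirac]
  have hAsucc (t : ℕ) : A t = P t + A (t + 1) := by
    -- Paths that first reach v at time t + 1 contribute nothing, since f v = 0.
    have h1 : A (t + 1) = ∫⁻ x in avoiding v t, f (x (t + 1)) ∂walkLaw G u := by
      simp only [hA]
      rw [← lintegral_indicator (measurableSet_avoiding v _),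
        ← lintegral_indicator (measurableSet_avoiding v _)]
      refine lintegral_congr fun x => ?_
      have : x ∈ avoiding v (t + 1) ↔ x ∈ avoiding v t ∧ x (t + 1) ≠ v := by
        simp only [avoiding, Set.mem_ofPred_eq, Nat.le_add_one_iff]
        grind
      by_cases hx : x (t + 1) = v
      · simp [Set.indicator, hx, hv]
      · have : x ∈ avoiding v (t + 1) ↔ x ∈ avoiding v t := by simp [this, hx]
        by_cases hx' : x ∈ avoiding v t <;> simp [this, hx']
    rw [h1, setLIntegral_avoiding_succ]
    simp only [hA, hP]
    rw [← setLIntegral_one, ← lintegral_add_left (by fun_prop)]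
    refine setLIntegral_congr_fun (measurableSet_avoiding v t) fun x hx => ?_
    exact hstep _ (hx t le_rfl)
  have hsum (T : ℕ) : ∑ t ∈ Finset.range T, P t + A T = f u := by
    induction T with
    | zero => simpa using hA0
    | succ T ih => rw [Finset.sum_range_succ, add_assoc, ← hAsucc, ih]
  have htsum : ∑' t, P t ≠ ∞ := by
    refine ne_top_of_le_ne_top (hfin u) (ENNReal.tsum_le_of_sum_range_le fun T => ?_)
    exact (hsum T) ▸ le_self_add
  have hP0 : Filter.Tendsto P Filter.atTop (nhds 0) := ENNReal.tendsto_atTop_zero_of_tsum_ne_top htsum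
  -- As V is finite, f is bounded by its total sum.
  have hAP (t : ℕ) : A t ≤ (∑ w, f w) * P t := by
    simp only [hA, hP]
    rw [← setLIntegral_const]
    exact lintegral_mono fun x =>
      Finset.single_le_sum (f := f) (fun _ _ => zero_le) (Finset.mem_univ (x t))
  have hAlim : Filter.Tendsto A Filter.atTop (nhds 0) := by
    refine tendsto_of_tendsto_of_tendsto_of_le_of_le tendsto_const_nhds ?_ (fun _ => zero_le) hAP
    simpa using ENNReal.Tendsto.const_mul hP0
      (Or.inr (ENNReal.sum_ne_top.2 fun w _ => hfin w))
  have hlim := (ENNReal.tendsto_nat_tsum P).add hAlim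
  simp only [hsum, add_zero] at hlim
  simp_rw [hittingAfter_eq_tsum]
  rw [lintegral_tsum fun t => (measurable_one.indicator (measurableSet_avoiding v t)).aemeasurable]
  simp_rw [lintegral_indicator_one (measurableSet_avoiding v _)]
  exact tendsto_nhds_unique hlim tendsto_const_nhds |>.symm ▸ rfl

open scoped Classical in
theorem lintegral_step {u : V} (h : (G.neighborFinset u).Nonempty) (f : V → ℝ≥0∞) :
    ∫⁻ y, f y ∂(step G u).toMeasure = (G.degree u : ℝ≥0∞)⁻¹ * ∑ y ∈ G.neighborFinset u, f y := by
  rw [lintegral_fintype, Finset.mul_sum, ← Finset.sum_subset (Finset.subset_univ (G.neighborFinset u))]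
  · refine Finset.sum_congr rfl fun y hy => ?_
    rw [PMF.toMeasure_apply_singleton _ _ (MeasurableSet.singleton y), step, dif_pos h,
      PMF.uniformOfFinset_apply_of_mem h hy, mul_comm, G.card_neighborFinset_eq_degree]
  · intro y _ hy
    rw [PMF.toMeasure_apply_singleton _ _ (MeasurableSet.singleton y), step, dif_pos h,
      PMF.uniformOfFinset_apply_of_notMem h hy, mul_zero]

end Walk

variable {V : Type*} [Fintype V] {G : SimpleGraph V}

theorem hittingTime_eq (hG : G.IsTree) (u v : V) :
    hittingTime G u v = ENNReal.ofReal (treePotential G u v) := by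
  classical
  let _ : MeasurableSpace V := ⊤
  refine lintegral_hittingAfter_eq (f := fun u => ENNReal.ofReal (treePotential G u v))
    (fun _ => ENNReal.ofReal_ne_top) (by simp [treePotential_self]) (fun u huv => ?_) u
  obtain ⟨p, hp, -⟩ := exists_adj_dist_of_ne hG huv
  have hne : (G.neighborFinset u).Nonempty := ⟨p, (G.mem_neighborFinset u p).2 hp⟩
  have hdeg : (0 : ℝ) < G.degree u := by
    exact_mod_cast G.card_neighborFinset_eq_degree u ▸ hne.card_pos
  have hsum := sum_neighborFinset_treePotential hG huv
  -- `ENNReal.ofReal` truncates negative values, so additivity needs this bound.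
  have hnn : 0 ≤ treePotential G u v - 1 := sub_nonneg.2 (one_le_treePotential hG huv)
  rw [lintegral_step hne, ← ENNReal.ofReal_sum_of_nonneg fun x _ => treePotential_nonneg hG x v,
    hsum, ENNReal.ofReal_mul hdeg.le, ENNReal.ofReal_natCast, ← mul_assoc,
    ENNReal.inv_mul_cancel (by exact_mod_cast hdeg.ne') (ENNReal.natCast_ne_top _), one_mul,
    ← ENNReal.ofReal_one, ← ENNReal.ofReal_add zero_le_one hnn]
  congr 1
  ring

open scoped Classical in
theorem closeness_eq (G : SimpleGraph V) (v : V) :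
    closeness G v = (∑ u, (G.dist u v : ℝ))⁻¹ := by
  rw [closeness, ← Finset.sum_sdiff (Finset.subset_univ {v})]
  simp

open scoped Classical in
theorem rwCloseness_eq (hG : G.IsTree) (v : V) :
    rwCloseness G v = (∑ u, treePotential G u v)⁻¹ := by
  rw [rwCloseness, ← Finset.sum_sdiff (Finset.subset_univ {v})]
  simp [hittingTime_eq hG, treePotential_self, ENNReal.toReal_ofReal (treePotential_nonneg hG _ _)]

end TreeCentrality

theorem mainTheorem5 {V : Type*} [Fintype V] (G : SimpleGraph V) (hG : G.IsTree) :
    (∀ u v : V, TreeCentrality.hittingTime G u v ≠ ∞) ∧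
    ∀ u v : V, TreeCentrality.closeness G u ≤ TreeCentrality.closeness G v ↔
      TreeCentrality.rwCloseness G u ≤ TreeCentrality.rwCloseness G v := by
  refine ⟨fun u v => TreeCentrality.hittingTime_eq hG u v ▸ ENNReal.ofReal_ne_top, fun u v => ?_⟩
  rw [TreeCentrality.closeness_eq, TreeCentrality.closeness_eq, TreeCentrality.rwCloseness_eq hG,
    TreeCentrality.rwCloseness_eq hG]
  classical
  -- With one node the sums are 0 and inversion does not reverse order; there u = v.
  rcases subsingleton_or_nontrivial V with hV | hV
  · simp [Subsingleton.elim u v]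
  have hD (v : V) : 0 < ∑ u, (G.dist u v : ℝ) := by
    obtain ⟨u, huv⟩ := exists_ne v
    exact Finset.sum_pos' (fun _ _ => Nat.cast_nonneg _)
      ⟨u, Finset.mem_univ u, by exact_mod_cast hG.connected.pos_dist_of_ne huv⟩
  have hS (v : V) : 0 < ∑ u, TreeCentrality.treePotential G u v := by
    obtain ⟨u, huv⟩ := exists_ne v
    exact Finset.sum_pos' (fun u _ => TreeCentrality.treePotential_nonneg hG u v)
      ⟨u, Finset.mem_univ u, zero_lt_one.trans_le (TreeCentrality.one_le_treePotential hG huv)⟩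
  obtain ⟨c, hc⟩ := TreeCentrality.exists_sum_treePotential_eq hG
  have hk : (0 : ℝ) < 2 * Fintype.card V - 1 := by
    have : (1 : ℝ) ≤ Fintype.card V := by exact_mod_cast Fintype.card_pos
    linarith
  rw [inv_le_inv₀ (hD u) (hD v), inv_le_inv₀ (hS u) (hS v), hc, hc, sub_le_sub_iff_right,
    mul_le_mul_iff_right₀ hk]
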